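/- Consider a two-layer network with one source $S$, $t$ relays and $m$ destinations $D_1,\dots,D_m$ ($m$ arbitrary): $S$ has an edge to every relay $j\in[t]$, and relay $j$ has an edge to $D_i$ exactly when $j\in\mathcal M_i$, where $\mathcal M_1,\dots,\mathcal M_m\subseteq[t]$ are nonempty. Each edge carries one symbol of a finite field $\mathbb F_q$ per channel use, without noise. The source has independent messages $W_1,\dots,W_m$ with finite alphabets, $W_i$ being intended for $D_i$, and unlimited private randomness $\Theta$ independent of them; the relays have no randomness. A rate tuple $(R_1,\dots,R_m)$ is securely achievable if for some $q$ and some block length $n\ge1$ there are such messages with $R_i=\frac1nH(W_i)$ (entropy in base $q$) and encoding functions, where the block $X_e^n\in\mathbb F_q^n$ sent on an edge $e$ is a function of $(W_1,\dots,W_m,\Theta)$ if $e$ leaves $S$ and of the blocks entering the tail of $e$ otherwise, such that $H(W_i\mid X_e^n: e \text{ enters } D_i)=0$ for all $i$ and $I(W_1,\dots,W_m;X^n_{\mathcal Z})=0$ for every set $\mathcal Z$ of at most $k=1$ edges. The secure capacity region is the closure of the set of securely achievable tuples. For $\mathcal A\subseteq[m]$ let $M_{\mathcal A}$ be the min-cut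 capacity (number of edges) between $S$ and $\{D_i:i\in\mathcal A\}$, and let $C_{\mathcal A}$ be the number of connected components of the graph on $\mathcal A$ in which $i\ne j$ are joined when $\mathcal M_i\cap\mathcal M_j\neq\emptyset$. Then: (1) The secure capacity region is $$\Big\{R\in\mathbb R_{\ge0}^m:\ \sum_{i\in\mathcal A}R_i\le M_{\mathcal A}-C_{\mathcal A}\ \text{ for all }\mathcal A\subseteq[m]\Big\}.$$ (2) This region equals $\{R\in\mathbb R_{\ge0}^m:\ \sum_{i\in\mathcal A}R_i\le M_{\mathcal A}-1\ \text{ for all nonempty }\mathcal A\subseteq[m]\}$. (3) For every finite field $\mathbb F_q$ and every $\mathcal A\subseteq[m]$, $\dim\big(\bigcap_{i\in\mathcal A}V_i\big)\le t-M_{\mathcal A}+C_{\mathcal A}$, where $V_i\subseteq\mathbb F_q^t$ is spanned by the all-ones vector and the unit vectors $e_j$, $j\in[t]\setminus\mathcal M_i$ (for $\mathcal A=\emptyset$ the intersection is $\mathbb F_q^t$). -/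

import Mathlib

open MeasureTheory ProbabilityTheory

noncomputable section

namespace SecureNetwork

/-! Shannon entropies of random variables with finite alphabets, in nats. -/

section Entropy

/-- Shannon entropy `H(X)` (natural logarithm) of a random variable with a finite alphabet. -/
def entropy {Ω S : Type} [MeasurableSpace Ω] [Finite S] (μ : Measure Ω) (X : Ω → S) : ℝ :=
  ∑ᶠ x : S, Real.negMulLog (μ.real (X ⁻¹' {x}))

/-- Conditional entropy `H(X | Y) = H(X, Y) - H(Y)`. -/
def condEntropy {Ω S T : Type} [MeasurableSpace Ω] [Finite S] [Finite T]
    (μ : Measure Ω) (X : Ω → S) (Y : Ω → T) : ℝ :=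
  entropy μ (fun ω => (X ω, Y ω)) - entropy μ Y

/-- Mutual information `I(X ; Y) = H(X) + H(Y) - H(X, Y)`. -/
def mutualInfo {Ω S T : Type} [MeasurableSpace Ω] [Finite S] [Finite T]
    (μ : Measure Ω) (X : Ω → S) (Y : Ω → T) : ℝ :=
  entropy μ X + entropy μ Y - entropy μ (fun ω => (X ω, Y ω))

end Entropy

/-- A directed acyclic network with one source, `m` destinations and finitely many
unit-capacity edges. -/
structure Network (m : ℕ) where
  /-- the nodes -/
  V : Type
  /-- the edges -/
  E : Type
  [finiteE : Finite E]
  tail : E → V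
  head : E → V
  source : V
  dest : Fin m → V
  acyclic : ∃ level : V → ℕ, ∀ e, level (tail e) < level (head e)

attribute [instance] Network.finiteE

namespace Network

variable {m : ℕ}

/-- The incoming edges of a node. -/
abbrev InEdge (N : Network m) (v : N.V) : Type := {e : N.E // N.head e = v}

/-- The capacity of the min-cut between the source and the destinations in `A`: the least number
of edges leaving a set `U` of nodes that contains the source and none of these destinations. -/
def minCut (N : Network m) (A : Finset (Fin m)) : ℕ :=
  sInf {c | ∃ U : Set N.V, N.source ∈ U ∧ (∀ i ∈ A, N.dest i ∉ U) ∧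
    c = {e : N.E | N.tail e ∈ U ∧ N.head e ∉ U}.ncard}

end Network

/-- A code of block length `n` over the alphabet `F`: independent messages `W i` with finite
alphabets, randomness `Θ` of the source (with values in any measurable space) independent of
the messages, encoding functions, and the symbols `X e` carried by the edges over the `n` channel
uses. The nodes other than the source have no randomness. -/
structure Code {m : ℕ} (N : Network m) (F : Type) (n : ℕ) where
  Ω : Type
  [measurableΩ : MeasurableSpace Ω]
  μ : Measure Ω
  [isProb : IsProbabilityMeasure μ]
  Msg : Fin m → Type
  [finiteMsg : ∀ i, Finite (Msg i)]
  [measurableMsg : ∀ i, MeasurableSpace (Msg i)]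
  [singletonMsg : ∀ i, MeasurableSingletonClass (Msg i)]
  W : ∀ i, Ω → Msg i
  measurable_W : ∀ i, Measurable (W i)
  indep_W : iIndepFun W μ
  Rand : Type
  [measurableRand : MeasurableSpace Rand]
  Θ : Ω → Rand
  measurable_Θ : Measurable Θ
  indep_Θ : IndepFun (fun ω i => W i ω) Θ μ
  /-- encoding functions used on the edges that leave the source -/
  srcEnc : N.E → (∀ i, Msg i) × Rand → (Fin n → F)
  measurable_srcEnc : ∀ e, @Measurable _ _ _ ⊤ (srcEnc e)
  /-- encoding functions used on the other edges -/
  relayEnc : ∀ e : N.E, (N.InEdge (N.tail e) → (Fin n → F)) → (Fin n → F)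
  X : N.E → Ω → (Fin n → F)
  X_source : ∀ e, N.tail e = N.source → ∀ ω, X e ω = srcEnc e (fun i => W i ω, Θ ω)
  X_relay : ∀ e, N.tail e ≠ N.source → ∀ ω, X e ω = relayEnc e (fun l => X l.1 ω)

attribute [instance] Code.measurableΩ Code.isProb Code.finiteMsg Code.measurableMsg
  Code.singletonMsg Code.measurableRand

namespace Code

variable {m : ℕ} {N : Network m} {F : Type} {n : ℕ}

/-- Rate of the `i`-th message: `H(W i) / n`, entropy being measured in units of `log |F|`, so that
an edge has capacity one. -/
def rate (c : Code N F n) (i : Fin m) : ℝ :=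
  entropy c.μ (c.W i) / Real.log (Nat.card F) / n

/-- Every destination decodes its own message without error:
`H(W i | X e, e an incoming edge of D i) = 0`. -/
def Decodable [Finite F] (c : Code N F n) : Prop :=
  ∀ i, condEntropy c.μ (c.W i) (fun ω (e : N.InEdge (N.dest i)) => c.X e.1 ω) = 0

/-- Perfect secrecy against an eavesdropper of at most `k` edges of the network:
`I(W ; X e, e ∈ Z) = 0` whenever `|Z| ≤ k`. -/
def Secure [Finite F] (c : Code N F n) (k : ℕ) : Prop :=
  ∀ Z : Finset N.E, Z.card ≤ k →
    mutualInfo c.μ (fun ω i => c.W i ω) (fun ω (e : {e // e ∈ Z}) => c.X e.1 ω) = 0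

end Code

/-- The rate tuple `R` is securely achievable in the presence of an eavesdropper of `k` edges. -/
def SecurelyAchievable {m : ℕ} (N : Network m) (k : ℕ) (R : Fin m → ℝ) : Prop :=
  ∃ (F : Type) (_ : Field F) (_ : Finite F) (n : ℕ) (_ : 0 < n) (c : Code N F n),
    (∀ i, R i = c.rate i) ∧ c.Decodable ∧ c.Secure k

/-- The secure capacity region: the closure of the set of securely achievable rate tuples. -/
def secureCapacityRegion {m : ℕ} (N : Network m) (k : ℕ) : Set (Fin m → ℝ) :=
  closure {R | SecurelyAchievable N k R}

/-- The nodes of a two-layer network with `t` relays and `m` destinations. -/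
inductive Node (t m : ℕ) : Type
  | source : Node t m
  | relay : Fin t → Node t m
  | dest : Fin m → Node t m

/-- The level of a node: source 0, relays 1, destinations 2. -/
def Node.level {t m : ℕ} : Node t m → ℕ
  | .source => 0
  | .relay _ => 1
  | .dest _ => 2

/-- The two-layer network: an edge from the source to each of the `t` relays, and an edge from
relay `j` to destination `i` for each `j ∈ M i`. -/
def twoLayer {t m : ℕ} (M : Fin m → Finset (Fin t)) : Network m where
  V := Node t m
  E := Fin t ⊕ {p : Fin t × Fin m // p.1 ∈ M p.2}
  tail := Sum.elim (fun _ => Node.source) (fun p => Node.relay p.1.1)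
  head := Sum.elim (fun j => Node.relay j) (fun p => Node.dest p.1.2)
  source := Node.source
  dest := Node.dest
  acyclic := ⟨Node.level, by rintro (j | p) <;> simp [Node.level]⟩

/-- The graph on the destinations in which `i ≠ j` are joined when they share a relay. -/
def shareGraph {t m : ℕ} (M : Fin m → Finset (Fin t)) : SimpleGraph (Fin m) where
  Adj i j := i ≠ j ∧ (M i ∩ M j).Nonempty
  symm := ⟨fun i j h => ⟨h.1.symm, by rw [Finset.inter_comm]; exact h.2⟩⟩
  loopless := ⟨fun _ h => h.1 rfl⟩

/-- The number `C_A` of connected components of the graph induced on `A`. -/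
def numComponents {t m : ℕ} (M : Fin m → Finset (Fin t)) (A : Finset (Fin m)) : ℕ :=
  Nat.card ((shareGraph M).induce (A : Set (Fin m))).ConnectedComponent

/-- The matrix `V_i`: one row of `t` ones (the transpose of the Vandermonde matrix with a single
column), followed by the unit row vectors of the relays that are not connected to `i`. -/
def decodingMatrix {t m : ℕ} (F : Type*) [Field F] (M : Fin m → Finset (Fin t)) (i : Fin m) :
    Matrix (Fin 1 ⊕ {j : Fin t // j ∉ M i}) (Fin t) F :=
  Matrix.fromRows (Matrix.of fun _ _ => 1) (Matrix.of fun r => Pi.single r.1 1)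

/-- The row space of `V_i`, a subspace of `F ^ t`. -/
def rowSpace {t m : ℕ} (F : Type*) [Field F] (M : Fin m → Finset (Fin t)) (i : Fin m) :
    Submodule F (Fin t → F) :=
  Submodule.span F (Set.range (decodingMatrix F M i).row)

/-- The rate region `R ≥ 0`, `∑ i ∈ A, R i ≤ M_A - C_A` for all `A`. -/
def componentRegion {t m : ℕ} (M : Fin m → Finset (Fin t)) : Set (Fin m → ℝ) :=
  {R | (∀ i, 0 ≤ R i) ∧ ∀ A : Finset (Fin m),
    ∑ i ∈ A, R i ≤ ((twoLayer M).minCut A : ℝ) - (numComponents M A : ℝ)}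

/-- The region `R ≥ 0`, `∑ i ∈ A, R i ≤ M_A - k` for all nonempty `A`. -/
def cutSetRegion {m : ℕ} (N : Network m) (k : ℕ) : Set (Fin m → ℝ) :=
  {R | (∀ i, 0 ≤ R i) ∧ ∀ A : Finset (Fin m), A.Nonempty →
    ∑ i ∈ A, R i ≤ (N.minCut A : ℝ) - (k : ℝ)}

end SecureNetwork

end

/-!
The min-cut between the source and the destinations in `A` consists of the source edges of the
relays connected to `A` (`minCut_twoLayer`). Distinct components of `A` use disjoint sets of relays,
so the bounds `M - 1` for the components of `A` add up to `M_A - C_A`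
(`componentRegion_eq_cutSetRegion`). The row space of `V_i` consists of the vectors that are
constant on the relays of `i`; a vector of the intersection over `A` is thus given by one value for
each component and its coordinates outside the relays of `A`
(`finrank_iInf_rowSpace_add_le`).

The outer bound (`SecurelyAchievable.mem_cutSetRegion`): with `J` the relays connected to `A` and
`j₀ ∈ J`, the messages `W_A` are functions of the source blocks `X_J` and independent of `X_{j₀}`, so
`H(W_A) + H(X_{j₀}) = H(W_A, X_{j₀}) ≤ H(X_J) ≤ H(X_{j₀}) + (|J| - 1) n log q`.
The entropy inequalities all come from submodularity and `H ≤ log |alphabet|`, both consequences of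
Gibbs' inequality.

Achievability: the source adds the same uniform key block to the blocks of all relays and the relays
forward, so that a single edge reveals nothing (`keyCode_secure`), while the key cancels in the
difference of the symbols of two relays. Destination `i` can thus use the functionals
`x ↦ x ν j - x ν j'` with `j, j'` relays of `i`, where `ν` is a channel use. The functionals usable by
some `i ∈ A` annihilate exactly the sequences of `n` vectors of `⋂ V_i`, so by the dimension bound
they have rank at least `n (M_A - C_A)`. If `∑_{i ∈ A} d_i` never exceeds this number, Rado's theorem
(`exists_linearIndependent_of_card_le_finrank`) selects `d_i` functionals for each destination, all
linearly independent; they take arbitrary values simultaneously, namely the symbols of the messages.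
This achieves `d / n`, and such points are dense in the region.
-/

namespace SecureNetwork

/-! ### Entropy of random variables with finite alphabets -/

/-- Measurability with respect to the discrete `σ`-algebra of the codomain, the one that is
relevant for random variables with finite alphabets. -/
def DiscretelyMeasurable {Ω S : Type} [MeasurableSpace Ω] (X : Ω → S) : Prop :=
  ∀ s : Set S, MeasurableSet (X ⁻¹' s)

section Entropy

variable {Ω S T U : Type} [MeasurableSpace Ω]

lemma DiscretelyMeasurable.of_singleton [Finite S] {X : Ω → S}
    (h : ∀ x, MeasurableSet (X ⁻¹' {x})) : DiscretelyMeasurable X := by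
  intro s
  have : X ⁻¹' s = ⋃ x ∈ s, X ⁻¹' {x} := by ext; simp
  rw [this]
  exact MeasurableSet.biUnion s.toFinite.countable fun x _ => h x

lemma DiscretelyMeasurable.const (x : S) : DiscretelyMeasurable (fun _ : Ω => x) :=
  fun _ => MeasurableSet.const _

lemma DiscretelyMeasurable.comp {X : Ω → S} (h : DiscretelyMeasurable X) (f : S → T) :
    DiscretelyMeasurable (fun ω => f (X ω)) :=
  fun s => h (f ⁻¹' s)

lemma DiscretelyMeasurable.prodMk [Finite S] [Finite T] {X : Ω → S} {Y : Ω → T}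
    (hX : DiscretelyMeasurable X) (hY : DiscretelyMeasurable Y) :
    DiscretelyMeasurable (fun ω => (X ω, Y ω)) := by
  refine .of_singleton fun p => ?_
  have : (fun ω => (X ω, Y ω)) ⁻¹' {p} = X ⁻¹' {p.1} ∩ Y ⁻¹' {p.2} := by
    ext; simp [Prod.ext_iff]
  rw [this]
  exact (hX _).inter (hY _)

lemma DiscretelyMeasurable.pi {ι : Type} [Finite ι] {S : ι → Type} [∀ i, Finite (S i)]
    {X : ∀ i, Ω → S i} (hX : ∀ i, DiscretelyMeasurable (X i)) :
    DiscretelyMeasurable (fun ω i => X i ω) := by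
  refine .of_singleton fun f => ?_
  have : (fun ω i => X i ω) ⁻¹' {f} = ⋂ i, X i ⁻¹' {f i} := by
    ext; simp [funext_iff]
  rw [this]
  exact MeasurableSet.iInter fun i => hX i _

variable (μ : Measure Ω)

lemma entropy_eq_sum [Fintype S] (X : Ω → S) :
    entropy μ X = ∑ x, Real.negMulLog (μ.real (X ⁻¹' {x})) :=
  finsum_eq_sum_of_fintype _

/-- Relabelling the alphabet does not change the entropy. -/
lemma entropy_comp_of_injective [Finite S] [Finite T] (X : Ω → S) {f : S → T}
    (hf : Function.Injective f) : entropy μ (fun ω => f (X ω)) = entropy μ X := by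
  cases nonempty_fintype S
  cases nonempty_fintype T
  rw [entropy_eq_sum, entropy_eq_sum]
  symm
  refine Fintype.sum_of_injective f hf _ _ (fun y hy => ?_) (fun x => ?_)
  · have : (fun ω => f (X ω)) ⁻¹' {y} = ∅ := by
      ext ω
      simp only [Set.mem_preimage, Set.mem_singleton_iff, Set.mem_empty_iff_false, iff_false]
      exact fun h => hy ⟨_, h⟩
    simp [this]
  · congr 2
    ext ω
    simp [hf.eq_iff]

lemma mutualInfo_comm [Finite S] [Finite T] (X : Ω → S) (Y : Ω → T) :
    mutualInfo μ X Y = mutualInfo μ Y X := by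
  have h := entropy_comp_of_injective μ (fun ω => (X ω, Y ω)) Prod.swap_injective
  simp only [Prod.swap] at h
  rw [mutualInfo, mutualInfo, h, add_comm (entropy μ X)]

lemma condEntropy_comp_self [Finite S] [Finite T] (Y : Ω → T) (g : T → S) :
    condEntropy μ (fun ω => g (Y ω)) Y = 0 :=
  sub_eq_zero.2 (entropy_comp_of_injective μ Y (f := fun y => (g y, y))
    fun _ _ h => (Prod.ext_iff.1 h).2)

variable [IsProbabilityMeasure μ]

lemma sum_real_preimage_prodMk [Fintype S] [Fintype T] {X : Ω → S} {Y : Ω → T}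
    (hX : DiscretelyMeasurable X) (hY : DiscretelyMeasurable Y) (y : T) :
    ∑ x, μ.real ((fun ω => (X ω, Y ω)) ⁻¹' {(x, y)}) = μ.real (Y ⁻¹' {y}) := by
  classical
  rw [← measureReal_biUnion_finset]
  · congr 1
    ext ω
    simp
  · intro a _ b _ hab
    simp only [Function.onFun]
    rw [Set.disjoint_left]
    intro ω h1 h2
    simp only [Set.mem_preimage, Set.mem_singleton_iff, Prod.mk.injEq] at h1 h2
    exact hab (h1.1.symm.trans h2.1)
  · intro x _
    exact (hX.prodMk hY) _

lemma sum_real_preimage [Fintype S] {X : Ω → S} (hX : DiscretelyMeasurable X) :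
    ∑ x, μ.real (X ⁻¹' {x}) = 1 := by
  have h := sum_real_preimage_prodMk μ hX (Y := fun _ => ()) (.const ()) ()
  have h2 : ∀ x, (fun ω => (X ω, ())) ⁻¹' {(x, ())} = X ⁻¹' {x} := by
    intro x; ext; simp
  simpa [h2] using h

/-- Gibbs' inequality in a form without side conditions: it also holds, trivially, at `p = 0`. -/
lemma mul_log_sub_log_le {p q : ℝ} (hp : 0 ≤ p) (hq : 0 ≤ q) (h : p ≠ 0 → q ≠ 0) :
    p * (Real.log q - Real.log p) ≤ q - p := by
  rcases hp.eq_or_lt with rfl | hp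
  · simpa using hq
  · have hq' : 0 < q := hq.lt_of_ne' (h hp.ne')
    rw [← Real.log_div hq'.ne' hp.ne']
    have := Real.log_le_sub_one_of_pos (div_pos hq' hp)
    calc p * Real.log (q / p) ≤ p * (q / p - 1) := by gcongr
      _ = q - p := by field_simp

lemma entropy_le_log_card [Finite S] {X : Ω → S} (hX : DiscretelyMeasurable X) :
    entropy μ X ≤ Real.log (Nat.card S) := by
  cases nonempty_fintype S
  have hne : Nonempty S := by
    have : Nonempty Ω := nonempty_of_isProbabilityMeasure μ
    exact this.map X
  have hN : (0 : ℝ) < Fintype.card S := by exact_mod_cast Fintype.card_pos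
  rw [entropy_eq_sum, Nat.card_eq_fintype_card]
  have key : ∀ x, Real.negMulLog (μ.real (X ⁻¹' {x})) ≤
      ((Fintype.card S : ℝ)⁻¹ - μ.real (X ⁻¹' {x})) +
        μ.real (X ⁻¹' {x}) * Real.log (Fintype.card S) := by
    intro x
    have := mul_log_sub_log_le (p := μ.real (X ⁻¹' {x})) measureReal_nonneg
      (inv_nonneg.2 hN.le) (fun _ => (inv_pos.2 hN).ne')
    rw [Real.log_inv] at this
    rw [Real.negMulLog]
    linarith
  refine (Finset.sum_le_sum fun x _ => key x).trans ?_
  rw [Finset.sum_add_distrib, Finset.sum_sub_distrib, ← Finset.sum_mul, sum_real_preimage μ hX]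
  simp [hN.ne']

lemma entropy_eq_sum_prod [Fintype S] [Fintype T] {X : Ω → S} {Y : Ω → T}
    (hX : DiscretelyMeasurable X) (hY : DiscretelyMeasurable Y) :
    entropy μ Y = ∑ y, ∑ x,
      -(μ.real ((fun ω => (X ω, Y ω)) ⁻¹' {(x, y)}) * Real.log (μ.real (Y ⁻¹' {y}))) := by
  rw [entropy_eq_sum]
  refine Finset.sum_congr rfl fun y _ => ?_
  rw [Finset.sum_neg_distrib, ← Finset.sum_mul, sum_real_preimage_prodMk μ hX hY, Real.negMulLog]
  ring

lemma entropy_le_entropy_prodMk [Finite S] [Finite T] {X : Ω → S} {Y : Ω → T}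
    (hX : DiscretelyMeasurable X) (hY : DiscretelyMeasurable Y) :
    entropy μ Y ≤ entropy μ (fun ω => (X ω, Y ω)) := by
  cases nonempty_fintype S
  cases nonempty_fintype T
  rw [entropy_eq_sum_prod μ hX hY, entropy_eq_sum, Fintype.sum_prod_type_right]
  refine Finset.sum_le_sum fun y _ => Finset.sum_le_sum fun x _ => ?_
  rw [Real.negMulLog, neg_mul, neg_le_neg_iff]
  set p := μ.real ((fun ω => (X ω, Y ω)) ⁻¹' {(x, y)})
  rcases (measureReal_nonneg : 0 ≤ p).eq_or_lt with h | h
  · change 0 = p at h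
    simp [← h]
  · have : p ≤ μ.real (Y ⁻¹' {y}) := by
      refine measureReal_mono fun ω hω => ?_
      simp only [Set.mem_preimage, Set.mem_singleton_iff, Prod.mk.injEq] at hω
      exact hω.2
    gcongr

lemma entropy_comp_le [Finite S] [Finite T] {X : Ω → S} (hX : DiscretelyMeasurable X)
    (f : S → T) : entropy μ (fun ω => f (X ω)) ≤ entropy μ X := by
  rw [← entropy_comp_of_injective μ X (f := fun x => (x, f x))
    (fun a b h => (Prod.ext_iff.1 h).1)]
  exact entropy_le_entropy_prodMk μ hX (hX.comp f)

/-- Submodularity of the entropy, `H(X, Y, Z) + H(Z) ≤ H(X, Z) + H(Y, Z)`: Gibbs' inequality for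
the law of `(X, Y, Z)` against the one that makes `X` and `Y` independent given `Z`. -/
lemma entropy_submodular [Finite S] [Finite T] [Finite U] {X : Ω → S} {Y : Ω → T} {Z : Ω → U}
    (hX : DiscretelyMeasurable X) (hY : DiscretelyMeasurable Y) (hZ : DiscretelyMeasurable Z) :
    entropy μ (fun ω => (X ω, Y ω, Z ω)) + entropy μ Z ≤
      entropy μ (fun ω => (X ω, Z ω)) + entropy μ (fun ω => (Y ω, Z ω)) := by
  cases nonempty_fintype S
  cases nonempty_fintype T
  cases nonempty_fintype U
  set p : S → T → U → ℝ := fun x y z => μ.real ((fun ω => (X ω, Y ω, Z ω)) ⁻¹' {(x, y, z)}) with hp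
  set a : S → U → ℝ := fun x z => μ.real ((fun ω => (X ω, Z ω)) ⁻¹' {(x, z)}) with ha
  set b : T → U → ℝ := fun y z => μ.real ((fun ω => (Y ω, Z ω)) ⁻¹' {(y, z)}) with hb
  set c : U → ℝ := fun z => μ.real (Z ⁻¹' {z}) with hc
  have hpa : ∀ x z, ∑ y, p x y z = a x z := by
    intro x z
    refine Eq.trans ?_ (sum_real_preimage_prodMk μ hY (hX.prodMk hZ) (x, z))
    refine Finset.sum_congr rfl fun y _ => congrArg μ.real ?_
    ext ω
    simp only [Set.mem_preimage, Set.mem_singleton_iff, Prod.mk.injEq]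
    tauto
  have hpb : ∀ y z, ∑ x, p x y z = b y z := fun y z =>
    sum_real_preimage_prodMk μ hX (hY.prodMk hZ) (y, z)
  have hac : ∀ z, ∑ x, a x z = c z := sum_real_preimage_prodMk μ hX hZ
  have hbc : ∀ z, ∑ y, b y z = c z := sum_real_preimage_prodMk μ hY hZ
  have hp0 : ∀ x y z, 0 ≤ p x y z := fun _ _ _ => measureReal_nonneg
  have ha0 : ∀ x z, 0 ≤ a x z := fun _ _ => measureReal_nonneg
  have hb0 : ∀ y z, 0 ≤ b y z := fun _ _ => measureReal_nonneg
  have hc0 : ∀ z, 0 ≤ c z := fun _ => measureReal_nonneg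
  have hple : ∀ x y z, p x y z ≤ a x z := fun x y z => by
    rw [← hpa]; exact Finset.single_le_sum (fun y _ => hp0 x y z) (Finset.mem_univ y)
  have hplb : ∀ x y z, p x y z ≤ b y z := fun x y z => by
    rw [← hpb]; exact Finset.single_le_sum (fun x _ => hp0 x y z) (Finset.mem_univ x)
  have halc : ∀ x z, a x z ≤ c z := fun x z => by
    rw [← hac]; exact Finset.single_le_sum (fun x _ => ha0 x z) (Finset.mem_univ x)
  -- all four entropies as sums over the joint alphabet
  have e1 : entropy μ (fun ω => (X ω, Y ω, Z ω)) =
      ∑ z, ∑ x, ∑ y, -(p x y z * Real.log (p x y z)) := by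
    rw [entropy_eq_sum, Fintype.sum_prod_type]
    simp_rw [Fintype.sum_prod_type_right]
    rw [Finset.sum_comm]
    simp [Real.negMulLog, hp]
  have e2 : entropy μ Z = ∑ z, ∑ x, ∑ y, -(p x y z * Real.log (c z)) := by
    rw [entropy_eq_sum]
    refine Finset.sum_congr rfl fun z _ => ?_
    simp_rw [Finset.sum_neg_distrib, ← Finset.sum_mul, hpa, hac, Real.negMulLog, hc]
    ring
  have e3 : entropy μ (fun ω => (X ω, Z ω)) =
      ∑ z, ∑ x, ∑ y, -(p x y z * Real.log (a x z)) := by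
    rw [entropy_eq_sum, Fintype.sum_prod_type_right]
    refine Finset.sum_congr rfl fun z _ => Finset.sum_congr rfl fun x _ => ?_
    simp_rw [Finset.sum_neg_distrib, ← Finset.sum_mul, hpa, Real.negMulLog, ha]
    ring
  have e4 : entropy μ (fun ω => (Y ω, Z ω)) =
      ∑ z, ∑ x, ∑ y, -(p x y z * Real.log (b y z)) := by
    rw [entropy_eq_sum, Fintype.sum_prod_type_right]
    refine Finset.sum_congr rfl fun z _ => ?_
    rw [Finset.sum_comm]
    refine Finset.sum_congr rfl fun y _ => ?_
    simp_rw [Finset.sum_neg_distrib, ← Finset.sum_mul, hpb, Real.negMulLog, hb]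
    ring
  have key : ∀ z x y, -(p x y z * Real.log (p x y z)) + -(p x y z * Real.log (c z)) ≤
      (-(p x y z * Real.log (a x z)) + -(p x y z * Real.log (b y z))) +
        (a x z * b y z / c z - p x y z) := by
    intro z x y
    rcases (hp0 x y z).eq_or_lt with h | h
    · rw [← h]
      have := div_nonneg (mul_nonneg (ha0 x z) (hb0 y z)) (hc0 z)
      simpa using this
    · have h1 := h.trans_le (hple x y z)
      have h2 := h.trans_le (hplb x y z)
      have h3 := h1.trans_le (halc x z)
      have := mul_log_sub_log_le (hp0 x y z)
        (div_nonneg (mul_nonneg (ha0 x z) (hb0 y z)) (hc0 z)) (fun _ => by positivity)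
      rw [Real.log_div (by positivity) h3.ne', Real.log_mul h1.ne' h2.ne'] at this
      linarith
  have hzero : ∑ z, ∑ x, ∑ y, (a x z * b y z / c z - p x y z) = 0 := by
    refine Finset.sum_eq_zero fun z _ => ?_
    simp_rw [Finset.sum_sub_distrib, hpa, ← Finset.sum_div, ← Finset.mul_sum, hbc, hac]
    rw [← Finset.sum_mul, hac]
    simp [mul_self_div_self]
  rw [e1, e2, e3, e4, ← add_zero ((∑ z, ∑ x, ∑ y, -(p x y z * Real.log (a x z))) + _), ← hzero]
  simp_rw [← Finset.sum_add_distrib]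
  exact Finset.sum_le_sum fun z _ => Finset.sum_le_sum fun x _ => Finset.sum_le_sum fun y _ =>
    key z x y

lemma entropy_const (x : S) [Finite S] : entropy μ (fun _ : Ω => x) = 0 := by
  cases nonempty_fintype S
  rw [entropy_eq_sum]
  refine Finset.sum_eq_zero fun y _ => ?_
  by_cases h : x = y <;> simp [h]

lemma entropy_prodMk_le [Finite S] [Finite T] {X : Ω → S} {Y : Ω → T}
    (hX : DiscretelyMeasurable X) (hY : DiscretelyMeasurable Y) :
    entropy μ (fun ω => (X ω, Y ω)) ≤ entropy μ X + entropy μ Y := by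
  have h := entropy_submodular μ hX hY (Z := fun _ => ()) (.const ())
  have h1 := entropy_comp_of_injective μ (fun ω => (X ω, Y ω))
    (f := fun p : S × T => (p.1, p.2, ())) (fun a b h => by simpa [Prod.ext_iff] using h)
  have h2 := entropy_comp_of_injective μ X
    (f := fun p : S => (p, ())) (fun a b h => by simpa [Prod.ext_iff] using h)
  have h3 := entropy_comp_of_injective μ Y
    (f := fun p : T => (p, ())) (fun a b h => by simpa [Prod.ext_iff] using h)
  have h4 := entropy_const μ ()
  simp only at h1 h2 h3
  linarith

lemma entropy_prodMk_of_indepFun [Finite S] [Finite T] [MeasurableSpace S] [MeasurableSpace T]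
    [MeasurableSingletonClass S] [MeasurableSingletonClass T] {X : Ω → S} {Y : Ω → T}
    (hX : Measurable X) (hY : Measurable Y) (h : IndepFun X Y μ) :
    entropy μ (fun ω => (X ω, Y ω)) = entropy μ X + entropy μ Y := by
  cases nonempty_fintype S
  cases nonempty_fintype T
  have hX' : DiscretelyMeasurable X := .of_singleton fun x => hX (measurableSet_singleton x)
  have hY' : DiscretelyMeasurable Y := .of_singleton fun x => hY (measurableSet_singleton x)
  have hp : ∀ x y, μ.real ((fun ω => (X ω, Y ω)) ⁻¹' {(x, y)}) =
      μ.real (X ⁻¹' {x}) * μ.real (Y ⁻¹' {y}) := by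
    intro x y
    have := h.measure_inter_preimage_eq_mul {x} {y} (measurableSet_singleton x)
      (measurableSet_singleton y)
    have h2 : (fun ω => (X ω, Y ω)) ⁻¹' {(x, y)} = X ⁻¹' {x} ∩ Y ⁻¹' {y} := by ext; simp
    rw [h2, measureReal_def, this, ENNReal.toReal_mul, measureReal_def, measureReal_def]
  rw [entropy_eq_sum, Fintype.sum_prod_type]
  simp_rw [hp, Real.negMulLog_mul, Finset.sum_add_distrib, ← Finset.sum_mul, ← Finset.mul_sum]
  rw [← entropy_eq_sum, ← Finset.sum_mul, sum_real_preimage μ hX', sum_real_preimage μ hY',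
    ← entropy_eq_sum]
  ring

lemma entropy_pi_of_iIndepFun {ι : Type} {S : ι → Type} [∀ i, Finite (S i)]
    [∀ i, MeasurableSpace (S i)] [∀ i, MeasurableSingletonClass (S i)] {X : ∀ i, Ω → S i}
    (hX : ∀ i, Measurable (X i)) (h : iIndepFun X μ) (A : Finset ι) :
    entropy μ (fun ω (i : A) => X i ω) = ∑ i ∈ A, entropy μ (X i) := by
  classical
  induction A using Finset.induction_on with
  | empty =>
    have : (fun ω (i : (∅ : Finset ι)) => X i ω) = fun _ i => (isEmptyElim i) := by
      ext ω i; exact isEmptyElim i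
    rw [this, entropy_const]; simp
  | insert a A ha ih =>
    rw [Finset.sum_insert ha, ← ih]
    have h0 : IndepFun (X a) (fun ω (i : A) => X i ω) μ := by
      have h1 := h.indepFun_finset {a} A (by simpa using ha) hX
      have h2 : Measurable fun g : ∀ i : ({a} : Finset ι), S i =>
          g ⟨a, Finset.mem_singleton_self a⟩ := measurable_pi_apply _
      exact h1.comp h2 measurable_id
    rw [← entropy_prodMk_of_indepFun μ (hX a) 
      (measurable_pi_lambda (fun ω (i : A) => X i ω) fun i => hX i) h0]
    symm
    exact entropy_comp_of_injective μ (fun ω (i : (insert a A : Finset ι)) => X i ω)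
      (f := fun g => (g ⟨a, Finset.mem_insert_self a A⟩,
        fun i : A => g ⟨i, Finset.mem_insert_of_mem i.2⟩)) (fun g g' h => by
          simp only [Prod.mk.injEq, funext_iff, Subtype.forall] at h
          ext ⟨i, hi⟩
          rcases Finset.mem_insert.1 hi with rfl | hi'
          · exact h.1
          · exact h.2 i hi')

/-- A variable determined by `f Y` is determined by `Y`. -/
lemma entropy_prodMk_eq_of_condEntropy_comp_eq_zero [Finite S] [Finite T] [Finite U] {X : Ω → S}
    {Y : Ω → T} (hX : DiscretelyMeasurable X) (hY : DiscretelyMeasurable Y) (f : T → U)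
    (h : condEntropy μ X (fun ω => f (Y ω)) = 0) :
    entropy μ (fun ω => (X ω, Y ω)) = entropy μ Y := by
  refine le_antisymm ?_ (entropy_le_entropy_prodMk μ hX hY)
  have h1 := entropy_submodular μ hX hY (hY.comp f)
  have h2 := entropy_comp_of_injective μ (fun ω => (X ω, Y ω))
    (f := fun p : S × T => (p.1, p.2, f p.2)) (fun a b h => by
      simp only [Prod.mk.injEq] at h; exact Prod.ext h.1 h.2.1)
  have h3 := entropy_comp_of_injective μ Y
    (f := fun p : T => (p, f p)) (fun a b h => (Prod.ext_iff.1 h).1)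
  unfold condEntropy at h
  simp only at h2 h3
  linarith

/-- If every `X i` is determined by `Y`, so is their family. -/
lemma entropy_pi_prodMk_eq {ι : Type} {S : ι → Type} [∀ i, Finite (S i)] [Finite T]
    {X : ∀ i, Ω → S i} {Y : Ω → T} (hX : ∀ i, DiscretelyMeasurable (X i))
    (hY : DiscretelyMeasurable Y) (A : Finset ι)
    (h : ∀ i ∈ A, entropy μ (fun ω => (X i ω, Y ω)) = entropy μ Y) :
    entropy μ (fun ω => ((fun i : A => X i ω), Y ω)) = entropy μ Y := by
  classical
  refine le_antisymm ?_
    (entropy_le_entropy_prodMk μ (DiscretelyMeasurable.pi fun i : A => hX i) hY)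
  induction A using Finset.induction_on with
  | empty =>
    refine (entropy_comp_of_injective μ (fun ω => ((fun i : (∅ : Finset ι) => X i ω), Y ω))
      (f := Prod.snd) fun p q h => Prod.ext (Subsingleton.elim _ _) h).ge
  | insert a A ha ih =>
    have ih' := ih fun i hi => h i (Finset.mem_insert_of_mem hi)
    have h0 := h a (Finset.mem_insert_self a A)
    have h1 := entropy_submodular μ (hX a) (DiscretelyMeasurable.pi fun i : A => hX i) hY
    have h2 := entropy_comp_of_injective μ
      (fun ω => ((fun i : (insert a A : Finset ι) => X i ω), Y ω))
      (f := fun g => (g.1 ⟨a, Finset.mem_insert_self a A⟩,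
        (fun i : A => g.1 ⟨i, Finset.mem_insert_of_mem i.2⟩), g.2)) (fun g g' h => by
          simp only [Prod.mk.injEq, funext_iff, Subtype.forall] at h
          refine Prod.ext ?_ h.2.2
          ext ⟨i, hi⟩
          rcases Finset.mem_insert.1 hi with rfl | hi'
          · exact h.1
          · exact h.2.1 i hi')
    simp only at h2
    linarith

lemma mutualInfo_nonneg [Finite S] [Finite T] {X : Ω → S} {Y : Ω → T}
    (hX : DiscretelyMeasurable X) (hY : DiscretelyMeasurable Y) : 0 ≤ mutualInfo μ X Y :=
  sub_nonneg.2 (entropy_prodMk_le μ hX hY)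

/-- Data processing inequality. -/
lemma mutualInfo_comp_right_le [Finite S] [Finite T] [Finite U] {X : Ω → S} {Y : Ω → T}
    (hX : DiscretelyMeasurable X) (hY : DiscretelyMeasurable Y) (f : T → U) :
    mutualInfo μ X (fun ω => f (Y ω)) ≤ mutualInfo μ X Y := by
  have h1 := entropy_submodular μ hX hY (hY.comp f)
  have h2 := entropy_comp_of_injective μ (fun ω => (X ω, Y ω))
    (f := fun p : S × T => (p.1, p.2, f p.2)) (fun a b h => by
      simp only [Prod.mk.injEq] at h; exact Prod.ext h.1 h.2.1)
  have h3 := entropy_comp_of_injective μ Y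
    (f := fun p : T => (p, f p)) (fun a b h => (Prod.ext_iff.1 h).1)
  unfold mutualInfo
  simp only at h2 h3
  linarith

end Entropy

/-! ### Min-cuts and components of a two-layer network -/

section Combinatorics

variable {t m : ℕ} (M : Fin m → Finset (Fin t))

/-- The min-cut that separates the destinations in `A` is formed by the source edges of the relays
to which they are connected. -/
lemma minCut_twoLayer (A : Finset (Fin m)) : (twoLayer M).minCut A = (A.biUnion M).card := by
  classical
  have hmem : (A.biUnion M).card ∈ {c | ∃ U : Set (twoLayer M).V, (twoLayer M).source ∈ U ∧
      (∀ i ∈ A, (twoLayer M).dest i ∉ U) ∧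
        c = {e : (twoLayer M).E | (twoLayer M).tail e ∈ U ∧ (twoLayer M).head e ∉ U}.ncard} := by
    refine ⟨{v | (∀ i ∈ A, v ≠ Node.dest i) ∧ ∀ j ∈ A.biUnion M, v ≠ Node.relay j},
      ⟨fun i _ h => (by cases h), fun j _ h => (by cases h)⟩, fun i hi h => h.1 i hi rfl, ?_⟩
    rw [← Set.ncard_coe_finset, ← Set.ncard_image_of_injective _ Sum.inl_injective]
    congr 1
    ext e
    rcases e with j | ⟨⟨j, i⟩, hji⟩
    · constructor
      · rintro ⟨j', hj', h⟩
        cases h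
        exact ⟨⟨fun i _ h => (by cases h), fun j' _ h => (by cases h)⟩, fun h => h.2 j hj' rfl⟩
      · rintro ⟨-, h⟩
        by_contra hn
        refine h ⟨fun i _ h => (by cases h), fun j' hj' h => ?_⟩
        cases h
        exact hn ⟨j, hj', rfl⟩
    · simp only [twoLayer, Set.mem_image, reduceCtorEq, and_false, exists_false, false_iff,
        Set.mem_ofPred_eq, Sum.elim_inr, not_and, not_not]
      intro h
      refine ⟨fun i' hi' h' => ?_, fun j _ h' => by cases h'⟩
      cases h'
      exact h.2 j (Finset.mem_biUnion.2 ⟨i, hi', hji⟩) rfl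
  refine le_antisymm (Nat.sInf_le hmem) (le_csInf ⟨_, hmem⟩ ?_)
  · rintro c ⟨U, hs, hd, rfl⟩
    -- every relay `j` of the union contributes its source edge or an edge to a destination in `A`
    have hex : ∀ j ∈ A.biUnion M, ∃ e : (twoLayer M).E,
        ((twoLayer M).tail e ∈ U ∧ (twoLayer M).head e ∉ U) ∧
          Sum.elim id (fun p => p.1.1) e = j := by
      intro j hj
      obtain ⟨i, hi, hji⟩ := Finset.mem_biUnion.1 hj
      by_cases h : Node.relay j ∈ U
      · exact ⟨.inr ⟨(j, i), hji⟩, ⟨h, hd i hi⟩, rfl⟩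
      · exact ⟨.inl j, ⟨hs, h⟩, rfl⟩
    rw [← Set.ncard_coe_finset]
    refine (Set.ncard_le_ncard (t := Sum.elim id (fun p => p.1.1) ''
      {e : (twoLayer M).E | (twoLayer M).tail e ∈ U ∧ (twoLayer M).head e ∉ U}) ?_
      (Set.toFinite _)).trans (Set.ncard_image_le (Set.toFinite _))
    exact fun j hj => hex j hj

lemma numComponents_pos {A : Finset (Fin m)} (hA : A.Nonempty) : 1 ≤ numComponents M A := by
  have : Nonempty (A : Set (Fin m)) := hA.coe_sort
  have : Nonempty ((shareGraph M).induce (A : Set (Fin m))).ConnectedComponent :=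
    this.map (SimpleGraph.connectedComponentMk _)
  exact Nat.card_pos

/-- Distinct components do not share relays, so that the bounds for the components of `A` add up to
the one for `A`. -/
theorem componentRegion_eq_cutSetRegion :
    componentRegion M = cutSetRegion (twoLayer M) 1 := by
  classical
  ext R
  simp only [componentRegion, cutSetRegion, Set.mem_ofPred_eq, minCut_twoLayer, Nat.cast_one]
  refine and_congr_right fun hR => ⟨fun h A hA => (h A).trans ?_, fun h A => ?_⟩
  · have : (1 : ℝ) ≤ numComponents M A := by exact_mod_cast numComponents_pos M hA
    linarith
  · let G := (shareGraph M).induce (A : Set (Fin m))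
    have : Fintype G.ConnectedComponent := Fintype.ofFinite _
    let B : G.ConnectedComponent → Finset (Fin m) := fun c =>
      A.filter fun i => ∃ h : i ∈ A, G.connectedComponentMk ⟨i, h⟩ = c
    have hB : ∀ c i, i ∈ B c ↔ ∃ h : i ∈ A, G.connectedComponentMk ⟨i, h⟩ = c := by
      intro c i
      simp only [B, Finset.mem_filter, and_iff_right_iff_imp]
      rintro ⟨h, _⟩
      exact h
    have hdisj : ∀ c c' i i', i ∈ B c → i' ∈ B c' → c ≠ c' → Disjoint (M i) (M i') := by
      intro c c' i i' hi hi' hcc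
      obtain ⟨h, rfl⟩ := (hB _ _).1 hi
      obtain ⟨h', rfl⟩ := (hB _ _).1 hi'
      rw [Finset.disjoint_iff_inter_eq_empty, ← Finset.not_nonempty_iff_eq_empty]
      intro hne
      refine hcc (SimpleGraph.ConnectedComponent.sound (SimpleGraph.Adj.reachable ?_))
      refine ⟨?_, hne⟩
      rintro rfl
      exact hcc rfl
    have hBA : (Finset.univ.biUnion B) = A := by
      ext i
      simp only [Finset.mem_biUnion, Finset.mem_univ, true_and, hB]
      exact ⟨fun ⟨_, h, _⟩ => h, fun h => ⟨_, h, rfl⟩⟩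
    have hsum : ∑ i ∈ A, R i = ∑ c, ∑ i ∈ B c, R i := by
      rw [← Finset.sum_biUnion, hBA]
      intro c _ c' _ hcc
      rw [Function.onFun, Finset.disjoint_left]
      intro i hi hi'
      obtain ⟨h, rfl⟩ := (hB _ _).1 hi
      obtain ⟨h', rfl⟩ := (hB _ _).1 hi'
      exact hcc rfl
    have hcard : (A.biUnion M).card = ∑ c, ((B c).biUnion M).card := by
      rw [← Finset.card_biUnion, ← Finset.biUnion_biUnion, hBA]
      intro c _ c' _ hcc
      simp only [Function.onFun, Finset.disjoint_biUnion_left, Finset.disjoint_biUnion_right]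
      exact fun i hi i' hi' => hdisj c c' i' i hi' hi hcc
    have hne : ∀ c, (B c).Nonempty := by
      intro c
      induction c using SimpleGraph.ConnectedComponent.ind with
      | h v => exact ⟨v.1, (hB _ _).2 ⟨v.2, rfl⟩⟩
    rw [hsum, hcard, Nat.cast_sum]
    refine (Finset.sum_le_sum fun c _ => h (B c) (hne c)).trans (le_of_eq ?_)
    rw [Finset.sum_sub_distrib]
    simp [numComponents, Nat.card_eq_fintype_card, G]

end Combinatorics

/-! ### Intersections of the row spaces -/

section RowSpace

variable {t m : ℕ} (M : Fin m → Finset (Fin t)) (F : Type*) [Field F]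

/-- The row space of `V_i` consists of the vectors that are constant on the relays of `i`. -/
lemma mem_rowSpace {i : Fin m} {v : Fin t → F} :
    v ∈ rowSpace F M i ↔ ∀ j ∈ M i, ∀ j' ∈ M i, v j = v j' := by
  classical
  constructor
  · intro hv
    rw [rowSpace] at hv
    induction hv using Submodule.span_induction with
    | mem x hx =>
      obtain ⟨r, rfl⟩ := hx
      intro j hj j' hj'
      rcases r with r | ⟨r, hr⟩
      · simp [decodingMatrix]
      · have h1 : j ≠ r := fun h => hr (h ▸ hj)
        have h2 : j' ≠ r := fun h => hr (h ▸ hj')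
        simp [decodingMatrix, h1, h2]
    | zero => simp
    | add x y _ _ hx hy => intro j hj j' hj'; simp [hx j hj j' hj', hy j hj j' hj']
    | smul a x _ hx => intro j hj j' hj'; simp [hx j hj j' hj']
  · intro h
    obtain ⟨a, ha⟩ : ∃ a, ∀ j ∈ M i, v j = a := by
      rcases (M i).eq_empty_or_nonempty with h0 | ⟨j, hj⟩
      · exact ⟨0, by simp [h0]⟩
      · exact ⟨v j, fun j' hj' => h j' hj' j hj⟩
    have hv : v = a • (decodingMatrix F M i).row (.inl 0) +
        ∑ r : {j : Fin t // j ∉ M i}, (v r - a) • (decodingMatrix F M i).row (.inr r) := by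
      ext j
      by_cases hj : j ∈ M i
      · have : ∀ r : {j : Fin t // j ∉ M i}, j ≠ r := fun r h => r.2 (h ▸ hj)
        simp [decodingMatrix, ha j hj, this]
      · have : ∀ r : {j : Fin t // j ∉ M i}, j = r.1 ↔ (⟨j, hj⟩ : {j : Fin t // j ∉ M i}) = r :=
          fun r => by rw [Subtype.ext_iff]
        simp [decodingMatrix, Pi.single_apply, this]
    rw [hv]
    refine Submodule.add_mem _ (Submodule.smul_mem _ _ (Submodule.subset_span ⟨_, rfl⟩))
      (Submodule.sum_mem _ fun r _ => Submodule.smul_mem _ _ (Submodule.subset_span ⟨_, rfl⟩))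

/-- A vector of the intersection is constant on the relays of each component of `A`, so it is
determined by one value for each component and its coordinates at the relays not connected to
`A`. -/
theorem finrank_iInf_rowSpace_add_le (hM : ∀ i, (M i).Nonempty) (A : Finset (Fin m)) :
    Module.finrank F (⨅ i ∈ A, rowSpace F M i : Submodule F (Fin t → F)) + (A.biUnion M).card ≤
      t + numComponents M A := by
  classical
  let G := (shareGraph M).induce (A : Set (Fin m))
  have : Fintype G.ConnectedComponent := Fintype.ofFinite _
  choose j0 hj0 using hM
  let f : (Fin t → F) →ₗ[F] (G.ConnectedComponent ⊕ {j // j ∉ A.biUnion M} → F) :=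
    LinearMap.funLeft F F (Sum.elim (fun c => j0 c.out.1) Subtype.val)
  let Q : Submodule F (Fin t → F) := ⨅ i ∈ A, rowSpace F M i
  have hQ : ∀ v ∈ Q, ∀ i ∈ A, ∀ j ∈ M i, ∀ j' ∈ M i, v j = v j' := by
    intro v hv i hi
    rw [Submodule.mem_iInf] at hv
    have := hv i
    rw [Submodule.mem_iInf] at this
    exact (mem_rowSpace M F).1 (this hi)
  have hreach : ∀ v ∈ Q, ∀ i i' : (A : Set (Fin m)), G.Reachable i i' →
      v (j0 i) = v (j0 i') := by
    rintro v hv i i' ⟨w⟩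
    induction w with
    | nil => rfl
    | @cons a b c hab _ ih =>
      obtain ⟨j, hj⟩ := hab.2
      rw [Finset.mem_inter] at hj
      rw [hQ v hv a a.2 _ (hj0 a) j hj.1, hQ v hv b b.2 j hj.2 _ (hj0 b), ih]
  have hinj : Function.Injective (f.domRestrict Q) := by
    rw [injective_iff_map_eq_zero]
    rintro ⟨v, hv⟩ h0
    have h1 : ∀ r, v (Sum.elim (fun c : G.ConnectedComponent => j0 c.out.1) Subtype.val r) = 0 :=
      fun r => congrFun h0 r
    ext j
    by_cases hj : j ∈ A.biUnion M
    · obtain ⟨i, hi, hji⟩ := Finset.mem_biUnion.1 hj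
      have h2 := h1 (.inl (G.connectedComponentMk ⟨i, hi⟩))
      have h3 : G.Reachable (G.connectedComponentMk ⟨i, hi⟩).out ⟨i, hi⟩ :=
        SimpleGraph.ConnectedComponent.exact (Quot.out_eq _)
      have h4 := hreach v hv _ _ h3
      change v j = 0
      rw [hQ v hv i hi j hji _ (hj0 i), ← h2]
      exact h4.symm
    · exact h1 (.inr ⟨j, hj⟩)
  have := LinearMap.finrank_le_finrank_of_injective hinj
  rw [Module.finrank_pi, Fintype.card_sum, Fintype.card_subtype_compl, Fintype.card_fin,
    Fintype.card_coe] at this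
  have hle : (A.biUnion M).card ≤ t := by simpa using Finset.card_le_univ (A.biUnion M)
  have hG : numComponents M A = Fintype.card G.ConnectedComponent := Nat.card_eq_fintype_card
  change Module.finrank F Q + _ ≤ _
  omega

end RowSpace

/-! ### Rado's theorem for vectors -/

section Rado

variable {K V ι : Type*} [Field K] [AddCommGroup V] [Module K V]

lemma finrank_span_union_add_inter_le [DecidableEq V] (X Y : Finset V) :
    (↑(X ∪ Y) : Set V).finrank K + (↑(X ∩ Y) : Set V).finrank K ≤
      (X : Set V).finrank K + (Y : Set V).finrank K := by
  have : FiniteDimensional K (Submodule.span K (X : Set V)) :=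
    FiniteDimensional.span_finset K X
  have : FiniteDimensional K (Submodule.span K (Y : Set V)) :=
    FiniteDimensional.span_finset K Y
  have hinf : Submodule.span K (↑(X ∩ Y) : Set V) ≤
      Submodule.span K (X : Set V) ⊓ Submodule.span K (Y : Set V) :=
    le_inf (Submodule.span_mono (by simp)) (Submodule.span_mono (by simp))
  have h1 := Submodule.finrank_mono hinf
  have h2 := Submodule.finrank_sup_add_finrank_inf_eq (Submodule.span K (X : Set V))
    (Submodule.span K (Y : Set V))
  rw [← Submodule.span_union, ← Finset.coe_union] at h2
  unfold Set.finrank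
  omega

/-- Rado's theorem: a family of finite sets of vectors has linearly independent representatives if
the union of any `k` of the sets has rank at least `k`. In a family of least total size
with this property, no set has two elements: if neither of them could be dropped, submodularity of
the rank would contradict the property. -/
theorem exists_linearIndependent_of_card_le_finrank [Finite ι] [DecidableEq V] (S : ι → Finset V)
    (hS : ∀ A : Finset ι, A.card ≤ (↑(A.biUnion S) : Set V).finrank K) :
    ∃ f : ι → V, (∀ i, f i ∈ S i) ∧ LinearIndependent K f := by
  classical
  cases nonempty_fintype ι
  have hmono : ∀ {X Y : Finset V}, X ⊆ Y →
      (X : Set V).finrank K ≤ (Y : Set V).finrank K := by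
    intro X Y h
    have : FiniteDimensional K (Submodule.span K (Y : Set V)) :=
      FiniteDimensional.span_finset K Y
    exact Submodule.finrank_mono (Submodule.span_mono (by exact_mod_cast h))
  induction hN : ∑ i, (S i).card using Nat.strong_induction_on generalizing S with
  | _ N ih =>
  by_cases hone : ∀ i, ∀ x ∈ S i, ∀ y ∈ S i, x = y
  · have hne : ∀ i, (S i).Nonempty := by
      intro i
      by_contra h
      have := hS {i}
      rw [Finset.singleton_biUnion, Finset.not_nonempty_iff_eq_empty.1 h] at this
      simp [Set.finrank] at this
    choose f hf using hne
    refine ⟨f, hf, linearIndependent_iff_card_le_finrank_span.2 ?_⟩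
    have hr : (↑(Finset.univ.biUnion S) : Set V) = Set.range f := by
      ext v
      simp only [Finset.coe_biUnion, Finset.coe_univ, Set.mem_univ, Set.iUnion_true,
        Set.mem_iUnion, Finset.mem_coe, Set.mem_range]
      exact ⟨fun ⟨i, hi⟩ => ⟨i, hone i _ (hf i) _ hi⟩, fun ⟨i, hi⟩ => ⟨i, hi ▸ hf i⟩⟩
    rw [← hr]
    exact hS Finset.univ
  · push Not at hone
    obtain ⟨i, x, hx, y, hy, hxy⟩ := hone
    -- either `z` can be dropped from `S i`, or some `A` becomes tight
    have hdrop : ∀ z ∈ S i, (∃ f : ι → V, (∀ i, f i ∈ S i) ∧ LinearIndependent K f) ∨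
        ∃ A : Finset ι, i ∉ A ∧
          (↑(A.biUnion S ∪ (S i).erase z) : Set V).finrank K ≤ A.card := by
      intro z hz
      by_cases hcond : ∀ A : Finset ι, A.card ≤
          (↑(A.biUnion (Function.update S i ((S i).erase z))) : Set V).finrank K
      · left
        obtain ⟨f, hf, hli⟩ := ih _ (by
          rw [← hN]
          refine Finset.sum_lt_sum (fun k _ => ?_) ⟨i, Finset.mem_univ i, ?_⟩
          · by_cases hk : k = i
            · subst hk; simpa using Finset.card_le_card (Finset.erase_subset z (S k))
            · simp [hk]
          · simpa using Finset.card_erase_lt_of_mem hz) _ hcond rfl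
        refine ⟨f, fun k => ?_, hli⟩
        have := hf k
        by_cases hk : k = i
        · subst hk
          simp only [Function.update_self] at this
          exact Finset.mem_of_mem_erase this
        · simpa [hk] using this
      · right
        push Not at hcond
        obtain ⟨A, hA⟩ := hcond
        have heq : ∀ B : Finset ι, i ∉ B →
            B.biUnion (Function.update S i ((S i).erase z)) = B.biUnion S := by
          intro B hB
          refine Finset.biUnion_congr rfl fun k hk => ?_
          rw [Function.update_of_ne]
          rintro rfl
          exact hB hk
        have hiA : i ∈ A := by
          by_contra h
          rw [heq A h] at hA
          exact absurd (hS A) (not_le.2 hA)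
        refine ⟨A.erase i, Finset.notMem_erase i A, ?_⟩
        rw [← Finset.insert_erase hiA, Finset.biUnion_insert, Function.update_self,
          heq _ (Finset.notMem_erase i A), Finset.union_comm,
          Finset.card_insert_of_notMem (Finset.notMem_erase i A)] at hA
        omega
    rcases hdrop x hx with h | ⟨A, hiA, hA⟩
    · exact h
    rcases hdrop y hy with h | ⟨B, hiB, hB⟩
    · exact h
    exfalso
    have hsub := finrank_span_union_add_inter_le (K := K) (A.biUnion S ∪ (S i).erase x)
      (B.biUnion S ∪ (S i).erase y)
    have h1 := (hS (insert i (A ∪ B))).trans (hmono (Y := (A.biUnion S ∪ (S i).erase x) ∪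
      (B.biUnion S ∪ (S i).erase y)) (by
        intro v hv
        simp only [Finset.mem_biUnion, Finset.mem_insert, Finset.mem_union,
          Finset.mem_erase] at hv ⊢
        obtain ⟨k, rfl | hk | hk, hv⟩ := hv
        · by_cases hvx : v = x
          · exact .inr (.inr ⟨fun h => hxy (hvx.symm.trans h), hv⟩)
          · exact .inl (.inr ⟨hvx, hv⟩)
        · exact .inl (.inl ⟨k, hk, hv⟩)
        · exact .inr (.inl ⟨k, hk, hv⟩)))
    have h2 := (hS (A ∩ B)).trans (hmono (Y := (A.biUnion S ∪ (S i).erase x) ∩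
      (B.biUnion S ∪ (S i).erase y)) (by
        intro v hv
        simp only [Finset.mem_biUnion, Finset.mem_inter, Finset.mem_union] at hv ⊢
        obtain ⟨k, ⟨hk, hk'⟩, hv⟩ := hv
        exact ⟨.inl ⟨k, hk, hv⟩, .inl ⟨k, hk', hv⟩⟩))
    rw [Finset.card_insert_of_notMem (by simp [hiA, hiB])] at h1
    have h3 := Finset.card_union_add_card_inter A B
    omega

end Rado

/-! ### The outer bound -/

section Converse

variable {t m : ℕ} {M : Fin m → Finset (Fin t)} {F : Type} {n : ℕ}

namespace Code

lemma discretelyMeasurable_W {N : Network m} (c : Code N F n) (i : Fin m) :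
    DiscretelyMeasurable (c.W i) :=
  .of_singleton fun x => c.measurable_W i (measurableSet_singleton x)

lemma rate_nonneg {N : Network m} [Finite F] [Nonempty F] (c : Code N F n) (i : Fin m) :
    0 ≤ c.rate i := by
  have h : 0 ≤ entropy c.μ (c.W i) := by
    have := entropy_comp_le c.μ (c.discretelyMeasurable_W i) (fun _ => ())
    rwa [entropy_const] at this
  have h2 : 0 ≤ Real.log (Nat.card F) :=
    Real.log_nonneg (by exact_mod_cast Nat.card_pos)
  unfold rate
  positivity

/-- The block that the source sends to a relay. -/
def relayInput (c : Code (twoLayer M) F n) (j : Fin t) : c.Ω → (Fin n → F) :=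
  c.X (.inl j)

lemma discretelyMeasurable_relayInput (c : Code (twoLayer M) F n) (j : Fin t) :
    DiscretelyMeasurable (c.relayInput j) := by
  have h : c.relayInput j = fun ω => c.srcEnc (.inl j) (fun i => c.W i ω, c.Θ ω) :=
    funext (c.X_source (.inl j) rfl)
  intro s
  rw [h]
  have h2 : Measurable fun ω => ((fun i => c.W i ω), c.Θ ω) :=
    (measurable_pi_lambda _ c.measurable_W).prodMk c.measurable_Θ
  exact h2 (c.measurable_srcEnc (.inl j) trivial)

/-- What a destination receives is a function of the inputs of its relays. -/
lemma exists_destInput_eq (c : Code (twoLayer M) F n) {A : Finset (Fin m)} {i : Fin m}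
    (hi : i ∈ A) :
    ∃ f : (A.biUnion M → (Fin n → F)) → ((twoLayer M).InEdge ((twoLayer M).dest i) → Fin n → F),
      (fun ω (e : (twoLayer M).InEdge ((twoLayer M).dest i)) => c.X e.1 ω) =
        fun ω => f (fun j => c.relayInput j ω) := by
  have key : ∀ e : (twoLayer M).InEdge ((twoLayer M).dest i),
      ∃ g : (A.biUnion M → (Fin n → F)) → (Fin n → F),
        ∀ ω, c.X e.1 ω = g (fun j => c.relayInput j ω) := by
    rintro ⟨j | ⟨⟨j, i'⟩, hj⟩, he⟩
    · cases he
    · have hi' : i' = i := by cases he; rfl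
      subst hi'
      -- the only edge into relay `j` comes from the source
      have hin : ∀ l : (twoLayer M).InEdge (Node.relay j), l.1 = Sum.inl j := by
        rintro ⟨j' | p, hl⟩
        · cases hl; rfl
        · cases hl
      refine ⟨fun y => c.relayEnc (.inr ⟨(j, i'), hj⟩)
        (fun _ => y ⟨j, Finset.mem_biUnion.2 ⟨i', hi, hj⟩⟩), fun ω => ?_⟩
      rw [c.X_relay (.inr ⟨(j, i'), hj⟩) (fun h => by cases h)]
      congr 1
      funext l
      rw [hin l]
      rfl
  choose g hg using key
  exact ⟨fun y e => g e y, funext fun ω => funext fun e => hg e ω⟩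

end Code

/-- The outer bound. The messages of `A` are determined by the inputs of the relays connected to
`A`, and are independent of one of these inputs, so that only the others can carry them. -/
theorem SecurelyAchievable.mem_cutSetRegion (hM : ∀ i, (M i).Nonempty) {R : Fin m → ℝ}
    (h : SecurelyAchievable (twoLayer M) 1 R) : R ∈ cutSetRegion (twoLayer M) 1 := by
  classical
  obtain ⟨F, _, _, n, hn, c, hR, hdec, hsec⟩ := h
  refine ⟨fun i => hR i ▸ c.rate_nonneg i, fun A hA => ?_⟩
  obtain ⟨i0, hi0⟩ := hA
  obtain ⟨j0, hj0⟩ := hM i0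
  have hj0A : j0 ∈ A.biUnion M := Finset.mem_biUnion.2 ⟨i0, hi0, hj0⟩
  have hW := c.discretelyMeasurable_W
  have hX := c.discretelyMeasurable_relayInput
  set W : c.Ω → (∀ i : A, c.Msg i) := fun ω i => c.W i ω with hWdef
  set Y : c.Ω → (A.biUnion M → (Fin n → F)) := fun ω j => c.relayInput j ω with hYdef
  set Y' : c.Ω → ((A.biUnion M).erase j0 → (Fin n → F)) := fun ω j => c.relayInput j ω with hY'def
  have hWA : DiscretelyMeasurable W := DiscretelyMeasurable.pi fun i : A => hW i
  have hY : DiscretelyMeasurable Y := DiscretelyMeasurable.pi fun j => hX j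
  have hY' : DiscretelyMeasurable Y' := DiscretelyMeasurable.pi fun j => hX j
  -- decodability
  have h1 : entropy c.μ (fun ω => (W ω, Y ω)) = entropy c.μ Y := by
    refine entropy_pi_prodMk_eq c.μ hW hY A fun i hi => ?_
    obtain ⟨f, hf⟩ := c.exists_destInput_eq (A := A) hi
    have := hdec i
    rw [hf] at this
    exact entropy_prodMk_eq_of_condEntropy_comp_eq_zero c.μ (hW i) hY f this
  -- secrecy on the source edge of `j0`
  have h2 : mutualInfo c.μ W (c.relayInput j0) ≤ 0 := by
    let e0 : (twoLayer M).E := .inl j0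
    have hall : DiscretelyMeasurable (fun ω i => c.W i ω) := DiscretelyMeasurable.pi hW
    have hZ : DiscretelyMeasurable (fun ω (e : {e // e ∈ ({e0} : Finset _)}) => c.X e.1 ω) := by
      have : (fun ω (e : {e // e ∈ ({e0} : Finset _)}) => c.X e.1 ω) =
          fun ω _ => c.relayInput j0 ω := by
        funext ω e
        rw [Finset.mem_singleton.1 e.2]
        rfl
      rw [this]
      exact (hX j0).comp fun y _ => y
    calc mutualInfo c.μ W (c.relayInput j0)
        = mutualInfo c.μ (c.relayInput j0) W := mutualInfo_comm _ _ _
      _ ≤ mutualInfo c.μ (c.relayInput j0) (fun ω i => c.W i ω) :=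
          mutualInfo_comp_right_le c.μ (hX j0) hall (fun w (i : A) => w i)
      _ = mutualInfo c.μ (fun ω i => c.W i ω) (c.relayInput j0) := mutualInfo_comm _ _ _
      _ ≤ mutualInfo c.μ (fun ω i => c.W i ω)
            (fun ω (e : {e // e ∈ ({e0} : Finset _)}) => c.X e.1 ω) :=
          mutualInfo_comp_right_le c.μ hall hZ (fun y => y ⟨e0, Finset.mem_singleton_self e0⟩)
      _ = 0 := hsec {e0} (Finset.card_singleton _).le
  unfold mutualInfo at h2
  have h3 : entropy c.μ (fun ω => (W ω, c.relayInput j0 ω)) ≤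
      entropy c.μ (fun ω => (W ω, Y ω)) :=
    entropy_comp_le c.μ (hWA.prodMk hY) (fun p => (p.1, p.2 ⟨j0, hj0A⟩))
  have h4 : entropy c.μ Y ≤ entropy c.μ (c.relayInput j0) + entropy c.μ Y' := by
    refine le_trans (le_of_eq ?_) (entropy_prodMk_le c.μ (hX j0) hY')
    symm
    exact entropy_comp_of_injective c.μ Y
      (f := fun y => (y ⟨j0, hj0A⟩,
        fun j : (A.biUnion M).erase j0 => y ⟨j, Finset.mem_of_mem_erase j.2⟩)) (fun y y' h => by
          simp only [Prod.mk.injEq, funext_iff, Subtype.forall] at h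
          funext ⟨j, hj⟩
          by_cases hjj : j = j0
          · subst hjj; exact funext h.1
          · exact funext (h.2 j (Finset.mem_erase.2 ⟨hjj, hj⟩)))
  have h5 := entropy_le_log_card c.μ hY'
  have hlog : 0 < Real.log (Nat.card F) :=
    Real.log_pos (by exact_mod_cast Finite.one_lt_card)
  have hn' : (0 : ℝ) < n := by exact_mod_cast hn
  have hcard : Real.log (Nat.card ((A.biUnion M).erase j0 → (Fin n → F))) =
      (((A.biUnion M).card : ℝ) - 1) * n * Real.log (Nat.card F) := by
    have h1 : 1 ≤ (A.biUnion M).card := Finset.card_pos.2 ⟨j0, hj0A⟩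
    rw [Nat.card_fun, Nat.card_fun, Nat.card_eq_fintype_card (α := Fin n),
      Nat.card_eq_fintype_card (α := (A.biUnion M).erase j0), Fintype.card_coe,
      Finset.card_erase_of_mem hj0A, Fintype.card_fin]
    push_cast [Nat.cast_sub h1]
    rw [Real.log_pow, Real.log_pow, Nat.cast_sub h1]
    push_cast
    ring
  have hsum : ∑ i ∈ A, R i = entropy c.μ W / Real.log (Nat.card F) / n := by
    rw [hWdef, entropy_pi_of_iIndepFun c.μ c.measurable_W c.indep_W A, Finset.sum_div,
      Finset.sum_div]
    exact Finset.sum_congr rfl fun i _ => hR i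
  rw [hsum, minCut_twoLayer, Nat.cast_one, div_div, div_le_iff₀ (by positivity)]
  rw [hcard] at h5
  linarith

lemma isClosed_cutSetRegion (N : Network m) (k : ℕ) : IsClosed (cutSetRegion N k) := by
  have : cutSetRegion N k = (⋂ i, {R | 0 ≤ R i}) ∩
      ⋂ A : Finset (Fin m), ⋂ _ : A.Nonempty,
        {R | ∑ i ∈ A, R i ≤ (N.minCut A : ℝ) - (k : ℝ)} := by
    ext R
    simp [cutSetRegion]
  rw [this]
  refine (isClosed_iInter fun i => isClosed_le continuous_const (continuous_apply i)).inter
    (isClosed_iInter fun A => isClosed_iInter fun _ => isClosed_le ?_ continuous_const)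
  fun_prop

end Converse

/-! ### Linear codes with one key -/

section KeyCode

variable {t m n : ℕ} {d : Fin m → ℕ} {F : Type} [Field F] [Finite F] [MeasurableSpace F]

lemma entropy_of_map_eq_uniformOn {Ω S : Type} [MeasurableSpace Ω] [Finite S] [MeasurableSpace S]
    [MeasurableSingletonClass S] (μ : Measure Ω) [IsProbabilityMeasure μ] {X : Ω → S}
    (hX : Measurable X) (h : μ.map X = uniformOn Set.univ) :
    entropy μ X = Real.log (Nat.card S) := by
  cases nonempty_fintype S
  have hne : Nonempty S := by
    have : Nonempty Ω := nonempty_of_isProbabilityMeasure μ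
    exact this.map X
  have hN : (Fintype.card S : ℝ) ≠ 0 := by exact_mod_cast Fintype.card_ne_zero
  have hp : ∀ x, μ.real (X ⁻¹' {x}) = (Fintype.card S : ℝ)⁻¹ := by
    intro x
    rw [measureReal_def, ← Measure.map_apply hX (measurableSet_singleton x), h, uniformOn_univ,
      Measure.count_singleton]
    simp
  rw [entropy_eq_sum]
  simp [hp, Real.negMulLog, hN]

/-- The uniform law of the messages `w` and the key. -/
noncomputable def keyMeasure (d : Fin m → ℕ) (F : Type) [MeasurableSpace F] (n : ℕ) :
    Measure ((∀ i, Fin (d i) → F) × (Fin n → F)) :=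
  (Measure.pi fun i => uniformOn (Set.univ : Set (Fin (d i) → F))).prod
    (uniformOn (Set.univ : Set (Fin n → F)))

instance : IsProbabilityMeasure (keyMeasure d F n) := by
  unfold keyMeasure
  infer_instance

lemma map_fst_keyMeasure : (keyMeasure d F n).map Prod.fst =
    Measure.pi fun i => uniformOn (Set.univ : Set (Fin (d i) → F)) := by
  simp [keyMeasure, Measure.map_fst_prod]

lemma map_snd_keyMeasure : (keyMeasure d F n).map Prod.snd =
    uniformOn (Set.univ : Set (Fin n → F)) := by
  simp [keyMeasure, Measure.map_snd_prod]

lemma map_msg_keyMeasure (i : Fin m) : (keyMeasure d F n).map (fun ω => ω.1 i) =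
    uniformOn (Set.univ : Set (Fin (d i) → F)) := by
  have h := Measure.map_map (μ := keyMeasure d F n) (g := Function.eval i) (f := Prod.fst)
    (measurable_pi_apply i) measurable_fst
  rw [map_fst_keyMeasure] at h
  rw [← (measurePreserving_eval
    (fun i => uniformOn (Set.univ : Set (Fin (d i) → F))) i).map_eq, h]
  rfl

variable [MeasurableSingletonClass F]

/-- The code in which the source encodes the messages `w` into one block `s w · j` for each
relay `j` and sends it masked by a uniform key block, the same for all relays. The relays forward
what they receive. -/
noncomputable def keyCode (M : Fin m → Finset (Fin t))
    (s : (∀ i, Fin (d i) → F) → Fin n → Fin t → F) :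
    Code (twoLayer M) F n where
  Ω := (∀ i, Fin (d i) → F) × (Fin n → F)
  μ := keyMeasure d F n
  Msg i := Fin (d i) → F
  W i ω := ω.1 i
  measurable_W i := (measurable_pi_apply i).comp measurable_fst
  indep_W := by
    refine (iIndepFun_iff_map_fun_eq_pi_map
      fun i => ((measurable_pi_apply i).comp measurable_fst).aemeasurable).2 ?_
    exact map_fst_keyMeasure.trans
      (congrArg Measure.pi (funext fun i => (map_msg_keyMeasure i).symm))
  Rand := Fin n → F
  Θ := Prod.snd
  measurable_Θ := measurable_snd
  indep_Θ := indepFun_prod (X := id) (Y := id) measurable_id measurable_id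
  srcEnc e p ν := Sum.elim (fun j => s p.1 ν j + p.2 ν) (fun _ => 0) e
  measurable_srcEnc _ _ _ := MeasurableSet.of_discrete
  relayEnc e := match e with
    | .inl _ => fun _ => 0
    | .inr p => fun y => y ⟨.inl p.1.1, rfl⟩
  X e ω ν := s ω.1 ν (Sum.elim id (fun p => p.1.1) e) + ω.2 ν
  X_source e he ω := by
    rcases e with j | p
    · rfl
    · cases he
  X_relay e he ω := by
    rcases e with j | p
    · exact absurd rfl he
    · rfl

variable {M : Fin m → Finset (Fin t)} {s : (∀ i, Fin (d i) → F) → Fin n → Fin t → F}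

lemma keyCode_rate (i : Fin m) : (keyCode M s).rate i = d i / n := by
  have h : entropy (keyCode M s).μ ((keyCode M s).W i) = d i * Real.log (Nat.card F) := by
    refine (entropy_of_map_eq_uniformOn (keyMeasure d F n) (X := fun ω => ω.1 i)
      ((measurable_pi_apply i).comp measurable_fst) (map_msg_keyMeasure i)).trans ?_
    rw [Nat.card_fun, Nat.cast_pow, Real.log_pow, Nat.card_eq_fintype_card (α := Fin (d i)),
      Fintype.card_fin]
  have hlog : 0 < Real.log (Nat.card F) :=
    Real.log_pos (by exact_mod_cast Finite.one_lt_card)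
  rw [Code.rate, h, mul_div_cancel_right₀ _ hlog.ne']

/-- The key cancels in the difference of the symbols that two relays send. -/
lemma keyCode_decodable (hs : ∀ (i : Fin m) (k : Fin (d i)), ∃ ν, ∃ j ∈ M i, ∃ j' ∈ M i,
    ∀ w, s w ν j - s w ν j' = w i k) : (keyCode M s).Decodable := by
  intro i
  choose ν j hj j' hj' h using hs i
  obtain ⟨g, hg⟩ : ∃ g : ((twoLayer M).InEdge ((twoLayer M).dest i) → Fin n → F) →
      (keyCode M s).Msg i,
      (keyCode M s).W i = fun ω => g (fun e => (keyCode M s).X e.1 ω) := by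
    refine ⟨fun y k => y ⟨.inr ⟨(j k, i), hj k⟩, rfl⟩ (ν k) -
      y ⟨.inr ⟨(j' k, i), hj' k⟩, rfl⟩ (ν k), funext fun ω => funext fun k => ?_⟩
    exact (h k ω.1).symm.trans (add_sub_add_right_eq_sub _ _ _).symm
  rw [hg]
  exact condEntropy_comp_self _ _ g

/-- A block masked by the key reveals nothing about the messages: given the messages it determines
the key, whose entropy is the largest possible. -/
lemma mutualInfo_masked (f : (∀ i, Fin (d i) → F) → (Fin n → F)) :
    mutualInfo (keyMeasure d F n) Prod.fst (fun ω => f ω.1 + ω.2) = 0 := by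
  have hd : ∀ {S : Type} (X : (∀ i, Fin (d i) → F) × (Fin n → F) → S), DiscretelyMeasurable X :=
    fun X s => MeasurableSet.of_discrete
  refine le_antisymm ?_ (mutualInfo_nonneg _ (hd _) (hd _))
  have h1 := entropy_prodMk_of_indepFun (keyMeasure d F n) measurable_fst measurable_snd
    (indepFun_prod (X := id) (Y := id) measurable_id measurable_id)
  have h2 := entropy_comp_of_injective (keyMeasure d F n) (fun ω => (ω.1, ω.2))
    (f := fun p => (p.1, f p.1 + p.2)) (fun p q h => by
      obtain ⟨h1, h2⟩ := Prod.ext_iff.1 h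
      simp only at h1 h2
      rw [h1] at h2
      exact Prod.ext h1 (add_left_cancel h2))
  have h3 := entropy_of_map_eq_uniformOn (keyMeasure d F n) measurable_snd map_snd_keyMeasure
  have h4 := entropy_le_log_card (keyMeasure d F n) (hd fun ω => f ω.1 + ω.2)
  unfold mutualInfo
  simp only at h2
  linarith

lemma keyCode_secure : (keyCode M s).Secure 1 := by
  intro Z hZ
  have hd : ∀ {S : Type} (X : (∀ i, Fin (d i) → F) × (Fin n → F) → S), DiscretelyMeasurable X :=
    fun X s => MeasurableSet.of_discrete
  -- all edges of `Z` carry the same masked block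
  obtain ⟨f, hf⟩ : ∃ f : (∀ i, Fin (d i) → F) → (Fin n → F),
      ∀ e ∈ Z, ∀ ω, (keyCode M s).X e ω = f ω.1 + ω.2 := by
    rcases Z.eq_empty_or_nonempty with rfl | ⟨e, he⟩
    · exact ⟨0, fun e he => absurd he (Finset.notMem_empty e)⟩
    · refine ⟨fun w ν => s w ν (Sum.elim id (fun p => p.1.1) e), fun e' he' ω => ?_⟩
      rw [Finset.card_le_one.1 hZ e' he' e he]
      rfl
  have hX : (fun ω (e : {e // e ∈ Z}) => (keyCode M s).X e.1 ω) =
      fun ω _ => f ω.1 + ω.2 := funext fun ω => funext fun e => hf e.1 e.2 ω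
  rw [hX]
  exact le_antisymm ((mutualInfo_comp_right_le (keyMeasure d F n) (hd Prod.fst) (hd _)
    fun y (_ : {e // e ∈ Z}) => y).trans_eq (mutualInfo_masked f))
    (mutualInfo_nonneg _ (hd _) (hd _))

end KeyCode

/-! ### Achievability -/

section Achievability

variable {t m : ℕ} (M : Fin m → Finset (Fin t))

/-- Linearly independent functionals take arbitrary values simultaneously. -/
lemma surjective_pi_of_linearIndependent {K V ι : Type*} [Field K] [AddCommGroup V] [Module K V]
    [Finite ι] {φ : ι → Module.Dual K V} (h : LinearIndependent K φ) :
    Function.Surjective (LinearMap.pi φ) := by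
  classical
  cases nonempty_fintype ι
  rw [← LinearMap.range_eq_top]
  by_contra hne
  obtain ⟨f, hf, hle⟩ := Submodule.exists_le_ker_of_lt_top _ (lt_top_iff_ne_top.2 hne)
  refine hf (LinearMap.pi_ext' fun i => LinearMap.ext_ring ?_)
  refine (Fintype.linearIndependent_iff.1 h) (fun i => f (Pi.single i 1))
    (LinearMap.ext fun x => ?_) i
  have h0 : f (LinearMap.pi φ x) = 0 := hle ⟨x, rfl⟩
  rw [LinearMap.pi_apply_eq_sum_univ f] at h0
  have h1 : ∀ i : ι, (fun j => if i = j then (1 : K) else 0) = Pi.single i 1 := fun i => by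
    ext j
    simp [Pi.single_apply, eq_comm]
  simpa [LinearMap.sum_apply, mul_comm, h1] using h0

/-- The functional `x ↦ x ν j - x ν j'`. -/
def diffFunctional (F : Type) [Field F] {n t : ℕ} (ν : Fin n) (j j' : Fin t) :
    Module.Dual F (Fin n → Fin t → F) :=
  (LinearMap.proj (R := F) (φ := fun _ : Fin t => F) j -
      LinearMap.proj (R := F) (φ := fun _ : Fin t => F) j') ∘ₗ
    LinearMap.proj (R := F) (φ := fun _ : Fin n => Fin t → F) ν

lemma diffFunctional_apply (F : Type) [Field F] {n t : ℕ} (ν : Fin n) (j j' : Fin t)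
    (x : Fin n → Fin t → F) : diffFunctional F ν j j' x = x ν j - x ν j' := rfl

open Classical in
/-- The functionals of vanishing coefficient sum that destination `i` can use: the differences of
two symbols sent in the same channel use by relays of `i`. -/
noncomputable def decodingFunctionals (F : Type) [Field F] (n : ℕ) (i : Fin m) :
    Finset (Module.Dual F (Fin n → Fin t → F)) :=
  (Finset.univ ×ˢ M i ×ˢ M i).image fun p => diffFunctional F p.1 p.2.1 p.2.2

lemma mem_decodingFunctionals {F : Type} [Field F] {n : ℕ} {i : Fin m}
    {φ : Module.Dual F (Fin n → Fin t → F)} : φ ∈ decodingFunctionals M F n i ↔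
      ∃ ν, ∃ j ∈ M i, ∃ j' ∈ M i, diffFunctional F ν j j' = φ := by
  simp only [decodingFunctionals, Finset.mem_image, Finset.mem_product, Finset.mem_univ, true_and,
    Prod.exists]
  exact ⟨fun ⟨ν, j, j', h, e⟩ => ⟨ν, j, h.1, j', h.2, e⟩,
    fun ⟨ν, j, h, j', h', e⟩ => ⟨ν, j, j', ⟨h, h'⟩, e⟩⟩

lemma le_finrank_decodingFunctionals (hM : ∀ i, (M i).Nonempty) (F : Type) [Field F] (n : ℕ)
    (A : Finset (Fin m)) [DecidableEq (Module.Dual F (Fin n → Fin t → F))] :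
    n * (A.biUnion M).card ≤
      (↑(A.biUnion (decodingFunctionals M F n)) :
        Set (Module.Dual F (Fin n → Fin t → F))).finrank F + n * numComponents M A := by
  have h1 := Subspace.finrank_add_finrank_dualCoannihilator_eq
    (Submodule.span F (↑(A.biUnion (decodingFunctionals M F n)) :
        Set (Module.Dual F (Fin n → Fin t → F))))
  set K := (Submodule.span F (↑(A.biUnion (decodingFunctionals M F n)) :
        Set (Module.Dual F (Fin n → Fin t → F)))).dualCoannihilator with hK
  let Q : Submodule F (Fin t → F) := ⨅ i ∈ A, rowSpace F M i
  have hQ : ∀ x ∈ K, ∀ ν, x ν ∈ Q := by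
    intro x hx ν
    rw [Submodule.mem_iInf]
    intro i
    rw [Submodule.mem_iInf]
    intro hi
    rw [mem_rowSpace]
    intro j hj j' hj'
    rw [hK, Submodule.mem_dualCoannihilator] at hx
    have := hx (diffFunctional F ν j j') (Submodule.subset_span (by
      simp only [Finset.coe_biUnion, Set.mem_iUnion]
      exact ⟨i, hi, (mem_decodingFunctionals M).2 ⟨ν, j, hj, j', hj', rfl⟩⟩))
    rwa [diffFunctional_apply, sub_eq_zero] at this
  have h2 : Module.finrank F K ≤ n * Module.finrank F Q := by
    let f : K →ₗ[F] (Fin n → Q) := LinearMap.pi fun ν =>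
      ((LinearMap.proj ν : (Fin n → Fin t → F) →ₗ[F] (Fin t → F)).domRestrict K).codRestrict Q
        fun x => hQ x x.2 ν
    have hf : Function.Injective f := by
      intro x y h
      ext ν j
      exact congrFun (congrArg Subtype.val (congrFun h ν)) j
    have := LinearMap.finrank_le_finrank_of_injective hf
    rwa [Module.finrank_pi_fintype, Finset.sum_const, Finset.card_univ, Fintype.card_fin,
      smul_eq_mul] at this
  have h3 := finrank_iInf_rowSpace_add_le M F hM A
  change Module.finrank F Q + _ ≤ _ at h3
  have h4 : Module.finrank F (Fin n → Fin t → F) = n * t := by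
    simp [Module.finrank_pi_fintype]
  have h5 := Nat.mul_le_mul_left n h3
  rw [mul_add, mul_add] at h5
  unfold Set.finrank
  omega

/-- Integer points of the `n`-fold dilated region are achieved in `n` channel uses. -/
theorem securelyAchievable_div (hM : ∀ i, (M i).Nonempty) {n : ℕ} (hn : 0 < n) (d : Fin m → ℕ)
    (hd : ∀ A : Finset (Fin m),
      ∑ i ∈ A, d i + n * numComponents M A ≤ n * (A.biUnion M).card) :
    SecurelyAchievable (twoLayer M) 1 (fun i => (d i : ℝ) / n) := by
  classical
  let F := ZMod 2
  let _ : MeasurableSpace F := ⊤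
  have : DiscreteMeasurableSpace F := ⟨fun _ => trivial⟩
  obtain ⟨φ, hφ, hli⟩ := exists_linearIndependent_of_card_le_finrank (K := F)
    (ι := Σ i, Fin (d i)) (fun x => decodingFunctionals M F n x.1) (by
      intro A
      have h1 := le_finrank_decodingFunctionals M hM F n (A.image Sigma.fst)
      have h2 := hd (A.image Sigma.fst)
      have h3 : A.card ≤ ∑ i ∈ A.image Sigma.fst, d i := by
        calc A.card ≤ ((A.image Sigma.fst).sigma fun i => (Finset.univ : Finset (Fin (d i)))).card :=
              Finset.card_le_card fun x hx => by
                simpa using ⟨x.2, hx⟩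
          _ = _ := by simp
      have h4 : (A.image Sigma.fst).biUnion (decodingFunctionals M F n) =
          A.biUnion fun x => decodingFunctionals M F n x.1 := Finset.image_biUnion
      rw [h4] at h1
      omega)
  obtain ⟨s, hs⟩ := (surjective_pi_of_linearIndependent hli).hasRightInverse
  refine ⟨F, inferInstance, inferInstance, n, hn,
    keyCode M (fun w => s fun x : Σ i, Fin (d i) => w x.1 x.2),
    fun i => (keyCode_rate i).symm, keyCode_decodable fun i k => ?_, keyCode_secure⟩
  obtain ⟨ν, j, hj, j', hj', he⟩ := (mem_decodingFunctionals M).1 (hφ ⟨i, k⟩)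
  refine ⟨ν, j, hj, j', hj', fun w => ?_⟩
  have h := congrFun (hs fun x : Σ i, Fin (d i) => w x.1 x.2) ⟨i, k⟩
  rw [LinearMap.pi_apply, ← he] at h
  exact h

/-- Every point of the region is the limit of the rate tuples `⌊n R⌋ / n`. -/
theorem componentRegion_subset (hM : ∀ i, (M i).Nonempty) :
    componentRegion M ⊆ secureCapacityRegion (twoLayer M) 1 := by
  rintro R ⟨hR0, hR⟩
  refine mem_closure_of_tendsto (f := fun (n : ℕ) i => (⌊R i * n⌋₊ : ℝ) / n) (b := Filter.atTop)
    (tendsto_pi_nhds.2 fun i =>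
      (tendsto_nat_floor_mul_div_atTop (hR0 i)).comp tendsto_natCast_atTop_atTop) ?_
  filter_upwards [Filter.eventually_gt_atTop 0] with n hn
  refine securelyAchievable_div M hM hn (fun i => ⌊R i * n⌋₊) fun A => ?_
  have h1 := hR A
  rw [minCut_twoLayer] at h1
  have h2 : ∑ i ∈ A, (⌊R i * n⌋₊ : ℝ) ≤ (∑ i ∈ A, R i) * n := by
    rw [Finset.sum_mul]
    exact Finset.sum_le_sum fun i _ =>
      Nat.floor_le (mul_nonneg (hR0 i) n.cast_nonneg)
  have h3 : (∑ i ∈ A, R i) * n ≤ (((A.biUnion M).card : ℝ) - numComponents M A) * n := by gcongr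
  have : ((∑ i ∈ A, ⌊R i * n⌋₊ + n * numComponents M A : ℕ) : ℝ) ≤
      ((n * (A.biUnion M).card : ℕ) : ℝ) := by
    push_cast
    linarith
  exact_mod_cast this

end Achievability

end SecureNetwork

theorem theorem1 {t m : ℕ} (M : Fin m → Finset (Fin t)) (hM : ∀ i, (M i).Nonempty) :
    SecureNetwork.secureCapacityRegion (SecureNetwork.twoLayer M) 1 =
        SecureNetwork.componentRegion M ∧
      SecureNetwork.componentRegion M =
        SecureNetwork.cutSetRegion (SecureNetwork.twoLayer M) 1 ∧
      ∀ (F : Type) [Field F] [Finite F] (A : Finset (Fin m)),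
        (Module.finrank F
            (⨅ i ∈ A, SecureNetwork.rowSpace F M i : Submodule F (Fin t → F)) : ℤ) ≤
          (t : ℤ) - ((SecureNetwork.twoLayer M).minCut A : ℤ) +
            (SecureNetwork.numComponents M A : ℤ) := by
  refine ⟨Set.Subset.antisymm ?_ (SecureNetwork.componentRegion_subset M hM),
    SecureNetwork.componentRegion_eq_cutSetRegion M, fun F _ _ A => ?_⟩
  · rw [SecureNetwork.componentRegion_eq_cutSetRegion]
    exact closure_minimal (fun R hR => hR.mem_cutSetRegion hM)
      (SecureNetwork.isClosed_cutSetRegion _ _)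
  · have := SecureNetwork.finrank_iInf_rowSpace_add_le M F hM A
    rw [SecureNetwork.minCut_twoLayer]
    omega
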